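/- **Theorem 1.2.** Let $2^{\mathbb N}$ be the Cantor space, let $\mathbb B$ be the countable algebra of clopen subsets of $2^{\mathbb N}$ with the discrete topology, and let $H(2^{\mathbb N})$ be the group of homeomorphisms of $2^{\mathbb N}$ with the topology induced from the product space $\mathbb B^{\mathbb B}$ by the injection $\varphi\mapsto(U\mapsto\varphi[U])$. Call $\varphi\in H(2^{\mathbb N})$ *minimal* if the only closed sets $Y\subseteq 2^{\mathbb N}$ with $\varphi[Y]=Y$ are $\emptyset$ and $2^{\mathbb N}$, and let $\mathcal M\subseteq H(2^{\mathbb N})$ be the (Borel) set of minimal homeomorphisms. The standard Borel space of pointed Cantor minimal systems is $\mathcal M^*=\mathcal M\times 2^{\mathbb N}$, and $(\varphi,x),(\psi,y)\in\mathcal M^*$ are *topologically conjugate*, written $(\varphi,x)\cong^*_{tc}(\psi,y)$, if there is a homeomorphism $\pi$ of $2^{\mathbb N}$ with $\pi\circ\varphi=\psi\circ\pi$ and $\pi(x)=y$. Let $\Delta_{\mathbb R}^+$ be the equivalence relation on $\mathbb R^{\mathbb N}$ given by $$x\mathrel{\Delta_{\mathbb R}^+}y\iff\{x_i:i\in\mathbb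 N\}=\{y_i:i\in\mathbb N\}.$$ Then $\Delta_{\mathbb R}^+$ and $\cong^*_{tc}$ are Borel bireducible: there are Borel maps $f:\mathbb R^{\mathbb N}\to\mathcal M^*$ and $g:\mathcal M^*\to\mathbb R^{\mathbb N}$ such that $x\mathrel{\Delta_{\mathbb R}^+}y\iff f(x)\cong^*_{tc}f(y)$ for all $x,y\in\mathbb R^{\mathbb N}$, and $a\cong^*_{tc}b\iff g(a)\mathrel{\Delta_{\mathbb R}^+}g(b)$ for all $a,b\in\mathcal M^*$. -/

import Mathlib

open Set TopologicalSpace MeasureTheory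

namespace CantorMinimal

/-- The Cantor space `2^ℕ`, with its product topology and product (= Borel) σ-algebra. -/
abbrev CantorSpace : Type := ℕ → Bool

/-- The countable atomless Boolean algebra of clopen subsets of `2^ℕ`. -/
abbrev ClopenAlg : Type := Clopens CantorSpace

/-- The homeomorphism group `H(2^ℕ)`. -/
abbrev CantorHomeo : Type := CantorSpace ≃ₜ CantorSpace

/-- The clopen algebra is given the discrete topology. -/
instance : TopologicalSpace ClopenAlg := ⊥

instance : DiscreteTopology ClopenAlg := ⟨rfl⟩

/-- The automorphism `U ↦ φ[U]` of the clopen algebra induced by a homeomorphism `φ`. -/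
def imageClopen (φ : CantorHomeo) (U : ClopenAlg) : ClopenAlg :=
  ⟨φ '' U, φ.isClosedMap _ U.isClosed, φ.isOpenMap _ U.isOpen⟩

/-- The topology of `H(2^ℕ)`: the one it inherits from the product of discrete spaces
`ClopenAlg → ClopenAlg` through the injection `φ ↦ (U ↦ φ[U])`. -/
instance : TopologicalSpace CantorHomeo :=
  TopologicalSpace.induced imageClopen Pi.topologicalSpace

/-- `H(2^ℕ)` carries the Borel σ-algebra of its topology. -/
instance : MeasurableSpace CantorHomeo := borel CantorHomeo

instance : BorelSpace CantorHomeo := ⟨rfl⟩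

/-- A homeomorphism is minimal if it has no non-empty proper closed invariant subset. -/
def IsMinimalHomeo (φ : CantorHomeo) : Prop :=
  ∀ Y : Set CantorSpace, IsClosed Y → φ '' Y = Y → Y = ∅ ∨ Y = univ

/-- The space of minimal homeomorphisms of `2^ℕ`, a subspace of `H(2^ℕ)`. -/
abbrev MinimalHomeo : Type := {φ : CantorHomeo // IsMinimalHomeo φ}

/-- The space of pointed Cantor minimal systems `(2^ℕ, φ, x)`: pairs of a minimal
homeomorphism of `2^ℕ` and a point of `2^ℕ`, with the product σ-algebra. -/
abbrev PointedCantorMinimalSystem : Type := MinimalHomeo × CantorSpace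

/-- Pointed topological conjugacy: `(φ, x)` and `(ψ, y)` are equivalent if there is a
homeomorphism `π` with `π ∘ φ = ψ ∘ π` and `π x = y`. -/
def pointedConjugacy : Setoid PointedCantorMinimalSystem where
  r a b := ∃ π : CantorHomeo, (∀ z, π (a.1.1 z) = b.1.1 (π z)) ∧ π a.2 = b.2
  iseqv :=
    { refl := fun _ => ⟨Homeomorph.refl _, fun _ => rfl, rfl⟩
      symm := by
        rintro a b ⟨π, h, hx⟩
        refine ⟨π.symm, fun z => ?_, by rw [← hx, π.symm_apply_apply]⟩
        apply π.injective
        rw [h, π.apply_symm_apply, π.apply_symm_apply]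
      trans := by
        rintro a b c ⟨π, h, hx⟩ ⟨ρ, k, kx⟩
        refine ⟨π.trans ρ, fun z => ?_, ?_⟩
        · simp only [Homeomorph.trans_apply, h, k]
        · simp only [Homeomorph.trans_apply, hx, kx] }

/-- The relation `Δ_ℝ⁺` on `ℝ^ℕ`: two sequences are equivalent if they have the same set of
entries. -/
def deltaPlus : Setoid (ℕ → ℝ) where
  r x y := {t : ℝ | ∃ i, x i = t} = {t : ℝ | ∃ i, y i = t}
  iseqv := ⟨fun _ => rfl, fun h => h.symm, fun h k => h.trans k⟩

/-- `E ≤_B F` for equivalence relations on standard Borel spaces. -/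
def BorelReducible {X Y : Type} [MeasurableSpace X] [StandardBorelSpace X]
    [MeasurableSpace Y] [StandardBorelSpace Y] (E : Setoid X) (F : Setoid Y) : Prop :=
  ∃ f : X → Y, Measurable f ∧ ∀ x y, E x y ↔ F (f x) (f y)

/-- `E ∼_B F`: each of the two relations is Borel reducible to the other. -/
def BorelBireducible {X Y : Type} [MeasurableSpace X] [StandardBorelSpace X]
    [MeasurableSpace Y] [StandardBorelSpace Y] (E : Setoid X) (F : Setoid Y) : Prop :=
  BorelReducible E F ∧ BorelReducible F E

/-! The rest of the file proves that the space of pointed Cantor minimal systems is a standard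
Borel space. -/

instance : Countable ClopenAlg :=
  Clopens.countable_iff_secondCountable.2 inferInstance

instance : MeasurableSpace ClopenAlg := ⊤

instance : BorelSpace ClopenAlg := ⟨borel_eq_top_of_discrete.symm⟩

theorem clopen_separates {x y : CantorSpace} (h : ∀ V : ClopenAlg, x ∈ V ↔ y ∈ V) : x = y := by
  by_contra hxy
  obtain ⟨U, hU, hx, hy⟩ := exists_isClopen_of_totally_separated hxy
  exact hy ((h ⟨U, hU⟩).1 hx)

theorem exists_clopen_sub {O : Set CantorSpace} (hO : IsOpen O) {x : CantorSpace} (hx : x ∈ O) :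
    ∃ V : ClopenAlg, x ∈ V ∧ (V : Set CantorSpace) ⊆ O := by
  obtain ⟨V, hV, hxV, hVO⟩ := compact_exists_isClopen_in_isOpen hO hx
  exact ⟨⟨V, hV⟩, hxV, hVO⟩

theorem exists_dual_point (g : ClopenAlg ≃o ClopenAlg) (x : CantorSpace) :
    ∃ y : CantorSpace, ∀ V : ClopenAlg, y ∈ V ↔ x ∈ g V := by
  have key : ∀ V W : ClopenAlg, x ∈ g V → x ∈ g W → x ∈ g (V ⊓ W) := by
    intro V W hV hW
    rw [map_inf]
    exact ⟨hV, hW⟩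
  have hne : (⋂ V : {V : ClopenAlg // x ∈ g V}, (V.1 : Set CantorSpace)).Nonempty := by
    have : Nonempty {V : ClopenAlg // x ∈ g V} := ⟨⟨⊤, by rw [map_top]; trivial⟩⟩
    apply IsCompact.nonempty_iInter_of_directed_nonempty_isCompact_isClosed
    · intro V W
      exact ⟨⟨V.1 ⊓ W.1, key _ _ V.2 W.2⟩, fun z hz => hz.1, fun z hz => hz.2⟩
    · intro V
      by_contra h
      have h0 : V.1 = ⊥ := by
        apply Clopens.ext
        exact Set.not_nonempty_iff_eq_empty.1 h
      have := V.2
      rw [h0, map_bot] at this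
      exact this
    · exact fun V => V.1.isClosed.isCompact
    · exact fun V => V.1.isClosed
  obtain ⟨y, hy⟩ := hne
  have hy' : ∀ V : ClopenAlg, x ∈ g V → y ∈ V := fun V hV => mem_iInter.1 hy ⟨V, hV⟩
  refine ⟨y, fun V => ⟨fun hV => ?_, hy' V⟩⟩
  by_contra h
  have h1 : x ∈ g Vᶜ := by
    rw [map_compl]
    exact h
  exact hy' _ h1 hV

theorem exists_homeo_of_orderIso (g : ClopenAlg ≃o ClopenAlg) :
    ∃ φ : CantorHomeo, imageClopen φ = g := by
  choose a ha using exists_dual_point g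
  choose b hb using exists_dual_point g.symm
  have cont : ∀ (k : ClopenAlg ≃o ClopenAlg) (m : CantorSpace → CantorSpace),
      (∀ x V, m x ∈ V ↔ x ∈ k V) → Continuous m := by
    intro k m hm
    rw [continuous_iff_continuousAt]
    intro x
    rw [ContinuousAt, Filter.tendsto_def]
    intro s hs
    obtain ⟨O, hOs, hO, hx⟩ := mem_nhds_iff.1 hs
    obtain ⟨V, hxV, hVO⟩ := exists_clopen_sub hO hx
    exact Filter.mem_of_superset ((k V).isOpen.mem_nhds ((hm x V).1 hxV))
      fun z hz => hOs (hVO ((hm z V).2 hz))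
  have ab : ∀ x, a (b x) = x := fun x => clopen_separates fun V => by
    rw [ha, hb, OrderIso.symm_apply_apply]
  have ba : ∀ x, b (a x) = x := fun x => clopen_separates fun V => by
    rw [hb, ha, OrderIso.apply_symm_apply]
  refine ⟨⟨⟨b, a, ab, ba⟩, cont _ _ hb, cont _ _ ha⟩, ?_⟩
  funext U
  apply Clopens.ext
  ext z
  constructor
  · rintro ⟨w, hw, rfl⟩
    have : b w ∈ g U := (hb w _).2 (by rwa [OrderIso.symm_apply_apply])
    exact this
  · intro hz
    exact ⟨a z, (ha z U).2 hz, ba z⟩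

theorem mem_imageClopen {φ : CantorHomeo} {U : ClopenAlg} {z : CantorSpace} :
    φ z ∈ imageClopen φ U ↔ z ∈ U :=
  ⟨fun ⟨_, hw, h⟩ => φ.injective h ▸ hw, fun h => ⟨z, h, rfl⟩⟩

theorem imageClopen_injective : Function.Injective imageClopen := by
  intro φ ψ h
  ext1 z
  refine clopen_separates fun V => ?_
  obtain ⟨U, rfl⟩ : ∃ U, imageClopen φ U = V :=
    ⟨⟨φ ⁻¹' V, V.isClopen.preimage φ.continuous⟩,
      Clopens.ext (image_preimage_eq _ φ.surjective)⟩
  rw [mem_imageClopen, h, mem_imageClopen]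

theorem imageClopen_le {φ : CantorHomeo} {U V : ClopenAlg} :
    imageClopen φ U ≤ imageClopen φ V ↔ U ≤ V :=
  image_subset_image_iff φ.injective

theorem imageClopen_surjective (φ : CantorHomeo) : Function.Surjective (imageClopen φ) :=
  fun V => ⟨⟨φ ⁻¹' V, V.isClopen.preimage φ.continuous⟩,
    Clopens.ext (image_preimage_eq _ φ.surjective)⟩

theorem range_imageClopen : range imageClopen =
    {f | (∀ U V, f U ≤ f V ↔ U ≤ V) ∧ ∀ V, ∃ U, f U = V} := by
  ext f
  constructor
  · rintro ⟨φ, rfl⟩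
    exact ⟨fun U V => imageClopen_le, imageClopen_surjective φ⟩
  · rintro ⟨h, hs⟩
    have hinj : Function.Injective f := fun U V hUV =>
      le_antisymm ((h U V).1 hUV.le) ((h V U).1 hUV.ge)
    let g : ClopenAlg ≃o ClopenAlg :=
      { Equiv.ofBijective f ⟨hinj, hs⟩ with map_rel_iff' := fun {U V} => h U V }
    obtain ⟨φ, hφ⟩ := exists_homeo_of_orderIso g
    exact ⟨φ, hφ⟩

theorem measurableEmbedding_imageClopen : MeasurableEmbedding imageClopen := by
  have hs : MeasurableSpace.comap imageClopen inferInstance =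
      (inferInstance : MeasurableSpace CantorHomeo) := by
    change _ = borel CantorHomeo
    rw [BorelSpace.measurable_eq (α := ClopenAlg → ClopenAlg)]
    exact borel_comap.symm
  rw [MeasurableEmbedding.iff_comap_eq]
  refine ⟨imageClopen_injective, hs, ?_⟩
  rw [range_imageClopen]
  have hev : ∀ (P : ClopenAlg → ClopenAlg → Prop) (U V : ClopenAlg),
      MeasurableSet {f : ClopenAlg → ClopenAlg | P (f U) (f V)} := by
    intro P U V
    have hm : Measurable fun f : ClopenAlg → ClopenAlg => (f U, f V) :=
      (measurable_pi_apply U).prodMk (measurable_pi_apply V)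
    have hd : MeasurableSet {p : ClopenAlg × ClopenAlg | P p.1 p.2} := MeasurableSet.of_discrete
    exact hm hd
  have h1 : {f : ClopenAlg → ClopenAlg | (∀ U V, f U ≤ f V ↔ U ≤ V) ∧ ∀ V, ∃ U, f U = V} =
      (⋂ U, ⋂ V, {f : ClopenAlg → ClopenAlg | f U ≤ f V ↔ U ≤ V}) ∩
        ⋂ V, ⋃ U, {f : ClopenAlg → ClopenAlg | f U = V} := by
    ext f
    simp
  rw [h1]
  exact (MeasurableSet.iInter fun U => MeasurableSet.iInter fun V =>
    hev (fun A B => A ≤ B ↔ U ≤ V) U V).inter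
      (MeasurableSet.iInter fun V => MeasurableSet.iUnion fun U => hev (fun A _ => A = V) U U)

instance : StandardBorelSpace CantorHomeo := by
  have hme := measurableEmbedding_imageClopen
  have hr : StandardBorelSpace (range imageClopen) := hme.measurableSet_range.standardBorel
  obtain ⟨τ, hτ, hP⟩ := hr.polish
  let e := hme.equivRange
  refine ⟨τ.induced e, @BorelSpace.mk _ (τ.induced e) _ ?_, e.toEquiv.polishSpace_induced⟩
  have h := e.measurableEmbedding.comap_eq
  generalize (e : CantorHomeo → range imageClopen) = g at h ⊢
  rw [hτ.measurable_eq] at h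
  exact h.symm.trans borel_comap.symm

/-- The finite stages of the saturation of a clopen set under a homeomorphism. -/
def stage (φ : CantorHomeo) (U : ClopenAlg) : ℕ → ClopenAlg
  | 0 => U
  | n + 1 => stage φ U n ⊔ (imageClopen φ (stage φ U n) ⊔ imageClopen φ.symm (stage φ U n))

theorem isMinimalHomeo_iff (φ : CantorHomeo) :
    IsMinimalHomeo φ ↔ ∀ U : ClopenAlg, U ≠ ⊥ → ∃ n, stage φ U n = ⊤ := by
  constructor
  · intro h U hU
    have hsub : ∀ n, ∀ x ∈ stage φ U n, φ x ∈ stage φ U (n + 1) := fun n x hx =>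
      Or.inr (Or.inl ⟨x, hx, rfl⟩)
    have hsub' : ∀ n, ∀ x, φ x ∈ stage φ U n → x ∈ stage φ U (n + 1) := fun n x hx =>
      Or.inr (Or.inr ⟨φ x, hx, φ.symm_apply_apply x⟩)
    have hmono : Monotone (stage φ U) := monotone_nat_of_le_succ fun n => le_sup_left
    have hinv : ∀ x, φ x ∈ (⋃ n, (stage φ U n : Set CantorSpace)) ↔
        x ∈ ⋃ n, (stage φ U n : Set CantorSpace) := by
      intro x
      simp only [mem_iUnion]
      exact ⟨fun ⟨n, hn⟩ => ⟨n + 1, hsub' n x hn⟩, fun ⟨n, hn⟩ => ⟨n + 1, hsub n x hn⟩⟩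
    have hopen : IsOpen (⋃ n, (stage φ U n : Set CantorSpace)) :=
      isOpen_iUnion fun n => (stage φ U n).isOpen
    have him : φ '' (⋃ n, (stage φ U n : Set CantorSpace))ᶜ =
        (⋃ n, (stage φ U n : Set CantorSpace))ᶜ := by
      ext y
      constructor
      · rintro ⟨x, hx, rfl⟩
        exact fun hy => hx ((hinv x).1 hy)
      · intro hy
        refine ⟨φ.symm y, fun hx => hy ?_, φ.apply_symm_apply y⟩
        have := (hinv (φ.symm y)).2 hx
        rwa [φ.apply_symm_apply] at this
    have hcov : (⋃ n, (stage φ U n : Set CantorSpace)) = univ := by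
      rcases h _ hopen.isClosed_compl him with h0 | h1
      · exact compl_empty_iff.1 h0
      · exfalso
        apply hU
        apply Clopens.ext
        refine eq_empty_of_forall_notMem fun x hx => ?_
        have hx' : x ∈ (⋃ n, (stage φ U n : Set CantorSpace))ᶜ := h1 ▸ mem_univ x
        exact hx' (mem_iUnion.2 ⟨0, hx⟩)
    obtain ⟨n, hn⟩ := isCompact_univ.elim_directed_cover
      (fun n => (stage φ U n : Set CantorSpace)) (fun n => (stage φ U n).isOpen) hcov.ge
      (directed_of_isDirected_le fun _ _ hmn => hmono hmn)
    exact ⟨n, Clopens.ext (univ_subset_iff.1 hn)⟩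
  · intro h Y hY hinv
    by_contra! hne
    obtain ⟨⟨y, hy⟩, hY1⟩ := hne
    obtain ⟨x, hx⟩ := (ne_univ_iff_exists_notMem Y).1 hY1
    obtain ⟨V, hxV, hVY⟩ := exists_clopen_sub hY.isOpen_compl hx
    obtain ⟨n, hn⟩ := h V (fun h0 => by rw [h0] at hxV; exact hxV)
    have hd : ∀ n, ∀ z ∈ stage φ V n, z ∉ Y := by
      intro n
      induction n with
      | zero => exact fun z hz => hVY hz
      | succ n ih =>
        rintro z (hz | ⟨w, hw, rfl⟩ | ⟨w, hw, rfl⟩) hzY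
        · exact ih z hz hzY
        · rw [← hinv] at hzY
          obtain ⟨v, hv, hvw⟩ := hzY
          exact ih w hw (φ.injective hvw ▸ hv)
        · refine ih w hw ?_
          rw [← hinv]
          exact ⟨_, hzY, φ.apply_symm_apply w⟩
    exact hd n y (hn ▸ trivial) hy

theorem measurable_imageClopen (U : ClopenAlg) :
    Measurable fun φ : CantorHomeo => imageClopen φ U :=
  (measurable_pi_apply U).comp measurableEmbedding_imageClopen.measurable

theorem measurable_imageClopen_symm (U : ClopenAlg) :
    Measurable fun φ : CantorHomeo => imageClopen φ.symm U := by
  refine measurable_to_countable' fun V => ?_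
  have : (fun φ : CantorHomeo => imageClopen φ.symm U) ⁻¹' {V} =
      (fun φ : CantorHomeo => imageClopen φ V) ⁻¹' {U} := by
    ext φ
    have h1 : ∀ (ψ : CantorHomeo) (W : ClopenAlg), imageClopen ψ (imageClopen ψ.symm W) = W :=
      fun ψ W => Clopens.ext (by
        change ψ '' (ψ.symm '' W) = W
        simp [image_image])
    constructor
    · rintro rfl
      exact h1 φ U
    · rintro rfl
      exact h1 φ.symm V
  rw [this]
  exact measurable_imageClopen V (measurableSet_singleton U)

theorem measurable_stage (U : ClopenAlg) (n : ℕ) :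
    Measurable fun φ : CantorHomeo => stage φ U n := by
  have happ : ∀ (F : CantorHomeo → ClopenAlg → ClopenAlg) (k : CantorHomeo → ClopenAlg),
      (∀ V, Measurable fun φ => F φ V) → Measurable k → Measurable fun φ => F φ (k φ) := by
    intro F k hF hk
    have : Measurable fun p : CantorHomeo × ClopenAlg => F p.1 p.2 :=
      measurable_from_prod_countable_left hF
    exact this.comp (measurable_id.prodMk hk)
  have hsup : Measurable fun p : ClopenAlg × ClopenAlg => p.1 ⊔ p.2 := Measurable.of_discrete
  induction n with
  | zero => exact measurable_const
  | succ n ih =>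
    exact hsup.comp (ih.prodMk (hsup.comp
      ((happ imageClopen _ measurable_imageClopen ih).prodMk
        (happ (fun φ => imageClopen φ.symm) _ measurable_imageClopen_symm ih))))

theorem measurableSet_isMinimalHomeo : MeasurableSet {φ : CantorHomeo | IsMinimalHomeo φ} := by
  simp only [isMinimalHomeo_iff, ofPred_forall, ofPred_exists]
  exact MeasurableSet.iInter fun U => MeasurableSet.iInter fun _ => MeasurableSet.iUnion fun n =>
    measurable_stage U n (measurableSet_singleton ⊤)

instance : StandardBorelSpace MinimalHomeo :=
  measurableSet_isMinimalHomeo.standardBorel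

end CantorMinimal

/-! The base point of a minimal system has a dense two-sided orbit, so a clopen set `U` is
determined by its set of visiting times `{n : φⁿ x ∈ U}`. These sets form a countable
shift-invariant Boolean algebra of subsets of `ℤ`. Stone duality makes this algebra, as a set of
subsets of `ℤ`, a complete invariant of pointed conjugacy (`pointedConjugacy_iff`). Coding subsets
of `ℤ` as reals and listing the algebra along an enumeration of the clopen sets gives the reduction
to `Δ_ℝ⁺`.

Conversely, a nonempty countable set `S` of points of the Cantor space is encoded in such an
algebra. The Toeplitz sequence of `c` reads at `n` whether `c` lies in the clopen set indexed by the
2-adic valuation of `3n - 1`. It oscillates as `n` tends 2-adically to `1/3`, while its nonzero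
translates settle down there. Hence the algebra generated by the translates for `c ∈ S` contains the
sequence of `r` only if `r ∈ S` (`toeplitz_mem_toeplitzAlgebra`), and so remembers `S`.

To realise this algebra on the Cantor space itself in a Borel way, the translates are read along `ℤ`
as a family in `2^ℕ` without isolated members, and the non-branching levels of its tree are deleted.
The result is a dense sequence with the prescribed visiting times (`mem_range_visits_compress`), and
the shift of `ℤ` induces a homeomorphism. It is minimal because every visit recurs along an
arithmetic progression. -/

namespace CantorMinimal

/-! ### Visiting times as a complete invariant -/

/-- The times at which a sequence of points visits a clopen set. -/
def visits (q : ℤ → CantorSpace) (U : ClopenAlg) : ℤ → Prop := fun n => q n ∈ U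

theorem visits_le_visits {q : ℤ → CantorSpace} (hq : DenseRange q) {U V : ClopenAlg} :
    visits q U ≤ visits q V ↔ U ≤ V := by
  refine ⟨fun h z hz => ?_, fun h n hn => h hn⟩
  by_contra hzV
  obtain ⟨n, hn⟩ := hq.exists_mem_open (U.isOpen.inter V.isClosed.isOpen_compl) ⟨z, hz, hzV⟩
  exact hn.2 (h n hn.1)

/-- By density `U ↦ visits q U` is an order embedding, so equal ranges yield an automorphism of the
clopen algebra, which is induced by a homeomorphism. -/
theorem exists_homeo_of_range_visits_eq {q q' : ℤ → CantorSpace} (hq : DenseRange q)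
    (hq' : DenseRange q') (h : range (visits q) = range (visits q')) :
    ∃ π : CantorHomeo, ∀ n, π (q n) = q' n := by
  have h1 : ∀ U, ∃ V, visits q' V = visits q U := fun U => by
    have : visits q U ∈ range (visits q') := h ▸ mem_range_self U
    exact this
  have h2 : ∀ V, ∃ U, visits q U = visits q' V := fun V => by
    have : visits q' V ∈ range (visits q) := h ▸ mem_range_self V
    exact this
  choose g hg using h1
  choose k hk using h2
  have inj : ∀ {q : ℤ → CantorSpace}, DenseRange q → ∀ {U V : ClopenAlg},
      visits q U = visits q V → U = V := fun hq _ _ huv =>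
    le_antisymm ((visits_le_visits hq).1 huv.le) ((visits_le_visits hq).1 huv.ge)
  let e : ClopenAlg ≃o ClopenAlg :=
    { toFun := g
      invFun := k
      left_inv := fun U => inj hq (by rw [hk, hg])
      right_inv := fun V => inj hq' (by rw [hg, hk])
      map_rel_iff' := fun {U V} => by
        change g U ≤ g V ↔ _
        rw [← visits_le_visits hq', hg, hg, visits_le_visits hq] }
  obtain ⟨π, hπ⟩ := exists_homeo_of_orderIso e
  refine ⟨π, fun n => clopen_separates fun V => ?_⟩
  obtain ⟨U, rfl⟩ := imageClopen_surjective π V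
  rw [mem_imageClopen, hπ]
  exact (iff_of_eq (congrFun (hg U) n)).symm

/-- The two-sided orbit of the base point of a pointed system. -/
def orbit (a : PointedCantorMinimalSystem) (n : ℤ) : CantorSpace := (a.1.1 ^ n) a.2

theorem orbit_zero (a : PointedCantorMinimalSystem) : orbit a 0 = a.2 := by
  simp [orbit]

theorem orbit_add_one (a : PointedCantorMinimalSystem) (n : ℤ) :
    orbit a (n + 1) = a.1.1 (orbit a n) := by
  simp only [orbit]
  rw [add_comm, zpow_add, zpow_one]
  rfl

theorem orbit_sub_one (a : PointedCantorMinimalSystem) (n : ℤ) :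
    orbit a (n - 1) = a.1.1.symm (orbit a n) := by
  rw [Homeomorph.eq_symm_apply, ← orbit_add_one, sub_add_cancel]

theorem eq_orbit {a : PointedCantorMinimalSystem} {q : ℤ → CantorSpace} (h0 : q 0 = a.2)
    (h : ∀ n, a.1.1 (q n) = q (n + 1)) : q = orbit a := by
  funext n
  induction n with
  | zero => rw [h0, orbit_zero]
  | succ n ih => rw [← h, ih, orbit_add_one]
  | pred n ih => rw [orbit_sub_one, Homeomorph.eq_symm_apply, h, sub_add_cancel, ih]

/-- The closure of the orbit is closed, invariant and nonempty. -/
theorem denseRange_orbit (a : PointedCantorMinimalSystem) : DenseRange (orbit a) := by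
  have him : a.1.1 '' range (orbit a) = range (orbit a) := by
    ext z
    constructor
    · rintro ⟨_, ⟨n, rfl⟩, rfl⟩
      exact ⟨n + 1, orbit_add_one a n⟩
    · rintro ⟨n, rfl⟩
      exact ⟨_, ⟨n - 1, rfl⟩, by rw [← orbit_add_one, sub_add_cancel]⟩
  rcases a.1.2 (closure (range (orbit a))) isClosed_closure
    (by rw [Homeomorph.image_closure, him]) with h | h
  · exact absurd (h ▸ subset_closure (mem_range_self 0)) (notMem_empty (orbit a 0))
  · exact fun z => h ▸ mem_univ z

theorem pointedConjugacy_iff (a b : PointedCantorMinimalSystem) :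
    pointedConjugacy a b ↔ range (visits (orbit a)) = range (visits (orbit b)) := by
  constructor
  · rintro ⟨π, hπ, h0⟩
    have hn : (fun n => π (orbit a n)) = orbit b :=
      eq_orbit (by rw [orbit_zero, h0]) fun n => by rw [orbit_add_one, hπ]
    have hv : ∀ U, visits (orbit b) (imageClopen π U) = visits (orbit a) U := fun U => by
      funext n
      rw [← hn]
      exact propext mem_imageClopen
    ext c
    constructor
    · rintro ⟨U, rfl⟩
      exact ⟨_, hv U⟩
    · rintro ⟨V, rfl⟩
      obtain ⟨U, rfl⟩ := imageClopen_surjective π V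
      exact ⟨U, (hv U).symm⟩
  · intro h
    obtain ⟨π, hπ⟩ :=
      exists_homeo_of_range_visits_eq (denseRange_orbit a) (denseRange_orbit b) h
    refine ⟨π, congrFun ((denseRange_orbit a).equalizer (π.continuous.comp a.1.1.continuous)
      (b.1.1.continuous.comp π.continuous) ?_), ?_⟩
    · funext n
      simp only [Function.comp_apply, hπ, ← orbit_add_one]
    · simpa only [orbit_zero] using hπ 0

/-! ### Borel reduction of pointed conjugacy to `Δ_ℝ⁺` -/

theorem measurableSet_clopenAlg (U : ClopenAlg) : MeasurableSet (U : Set CantorSpace) :=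
  U.isOpen.measurableSet

theorem measurable_homeo_apply {Ω : Type*} [MeasurableSpace Ω] {k : Ω → CantorHomeo}
    {z : Ω → CantorSpace} (hk : ∀ U, Measurable fun ω => imageClopen (k ω).symm U)
    (hz : Measurable z) : Measurable fun ω => k ω (z ω) := by
  refine measurable_pi_iff.2 fun i => measurable_to_bool ?_
  let U : ClopenAlg := ⟨{w | w i = true}, (isClopen_discrete {true}).preimage (continuous_apply i)⟩
  have : (fun ω => k ω (z ω) i) ⁻¹' {true} =
      ⋃ V : ClopenAlg, (fun ω => imageClopen (k ω).symm U) ⁻¹' {V} ∩ z ⁻¹' V := by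
    ext ω
    have h1 : z ω ∈ imageClopen (k ω).symm U ↔ k ω (z ω) i = true := by
      conv_lhs => rw [← (k ω).symm_apply_apply (z ω)]
      exact mem_imageClopen
    simp only [mem_iUnion, mem_inter_iff, mem_preimage, mem_singleton_iff]
    exact ⟨fun h => ⟨_, rfl, h1.2 h⟩, fun ⟨V, hV, hz⟩ => h1.1 (hV ▸ hz)⟩
  rw [this]
  exact MeasurableSet.iUnion fun V =>
    (hk U (measurableSet_singleton V)).inter (hz (measurableSet_clopenAlg V))

theorem measurable_orbit (n : ℤ) : Measurable fun a => orbit a n := by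
  have hφ : Measurable fun a : PointedCantorMinimalSystem => a.1.1 :=
    measurable_subtype_coe.comp measurable_fst
  induction n with
  | zero =>
    simp only [orbit_zero]
    exact measurable_snd
  | succ n ih =>
    simp only [orbit_add_one]
    exact measurable_homeo_apply (fun U => (measurable_imageClopen_symm U).comp hφ) ih
  | pred n ih =>
    simp only [orbit_sub_one]
    exact measurable_homeo_apply (fun U => (measurable_imageClopen U).comp hφ) ih

theorem pointedConjugacy_le_deltaPlus : BorelReducible pointedConjugacy deltaPlus := by
  obtain ⟨enum, henum⟩ := exists_surjective_nat ClopenAlg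
  obtain ⟨code, hcode⟩ := exists_measurableEmbedding_real (ℤ → Prop)
  refine ⟨fun a i => code (visits (orbit a) (enum i)), ?_, fun a b => ?_⟩
  · refine measurable_pi_iff.2 fun i => hcode.measurable.comp (measurable_pi_iff.2 fun n => ?_)
    exact measurable_to_prop (by
      have := measurable_orbit n (measurableSet_clopenAlg (enum i))
      convert this using 1
      ext a
      simp [visits])
  · have key : ∀ a, {t | ∃ i, code (visits (orbit a) (enum i)) = t} =
        code '' range (visits (orbit a)) := fun a => by
      rw [← henum.range_comp, ← range_comp]
      rfl
    change _ ↔ {t | ∃ i, code (visits (orbit a) (enum i)) = t} =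
      {t | ∃ i, code (visits (orbit b) (enum i)) = t}
    rw [pointedConjugacy_iff, key, key, hcode.injective.image_injective.eq_iff]

/-! ### Straightening a family without isolated members to a dense one -/

section Compression

variable {ι : Type*} (b : ι → ℕ → Bool)

/-- The sequences of the family `b` that agree with `b i` below `j` do not all agree at `j`. -/
def IsBranching (i : ι) (j : ℕ) : Prop := ∃ i', (∀ k < j, b i' k = b i k) ∧ b i' j ≠ b i j

/-- Keep only the terms at branching levels: this carries a family of sequences that has no
isolated members onto a dense family. -/
noncomputable def compress (i : ι) (t : ℕ) : Bool := b i (Nat.nth (IsBranching b i) t)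

/-- No member of the family is isolated from those that differ from it. -/
def NoIsolated : Prop := ∀ i N, ∃ i', (∀ k < N, b i' k = b i k) ∧ b i' ≠ b i

variable {b}

theorem exists_first_ne {f g : ℕ → Bool} {j : ℕ} (h : f j ≠ g j) :
    ∃ k ≤ j, (∀ l < k, f l = g l) ∧ f k ≠ g k := by
  classical
  have hex : ∃ k, f k ≠ g k := ⟨j, h⟩
  exact ⟨Nat.find hex, Nat.find_min' hex h, fun l hl => not_not.1 (Nat.find_min hex hl),
    Nat.find_spec hex⟩

theorem isBranching_congr {i i' : ι} {j : ℕ} (h : ∀ k < j, b i k = b i' k) :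
    IsBranching b i j ↔ IsBranching b i' j := by
  have key : ∀ {i i' : ι}, (∀ k < j, b i k = b i' k) → IsBranching b i j →
      IsBranching b i' j := by
    rintro i i' h ⟨m, hm, hne⟩
    by_cases hj : b i j = b i' j
    · exact ⟨m, fun k hk => (hm k hk).trans (h k hk), hj ▸ hne⟩
    · exact ⟨i, h, hj⟩
  exact ⟨key h, key fun k hk => (h k hk).symm⟩

theorem exists_branching_ge (hb : NoIsolated b) (i : ι) (N : ℕ) :
    ∃ j ≥ N, IsBranching b i j := by
  obtain ⟨i', h, hne⟩ := hb i N
  obtain ⟨j, hj⟩ := Function.ne_iff.1 hne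
  obtain ⟨k, -, hk, hk'⟩ := exists_first_ne hj
  exact ⟨k, not_lt.1 fun hlt => hk' (h k hlt), i', hk, hk'⟩

theorem infinite_branching (hb : NoIsolated b) (i : ι) :
    (Set.ofPred (IsBranching b i)).Infinite :=
  infinite_of_not_bddAbove fun ⟨N, hN⟩ => by
    obtain ⟨j, hj, hbr⟩ := exists_branching_ge hb i (N + 1)
    exact absurd (hN hbr) (by omega)

open Classical in
theorem count_branching_congr {i i' : ι} {j : ℕ} (h : ∀ k < j, b i k = b i' k) :
    Nat.count (IsBranching b i) j = Nat.count (IsBranching b i') j := by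
  rw [Nat.count_eq_card_filter_range, Nat.count_eq_card_filter_range]
  congr 1
  refine Finset.filter_congr fun k hk => isBranching_congr fun l hl => h l ?_
  exact hl.trans (Finset.mem_range.1 hk)

open Classical in
-- Being a branching level depends only on the terms strictly below it. Equality in `hN` is thus
-- allowed: the two sequences may already differ at that level.
theorem nth_branching_congr (hb : NoIsolated b) {i i' : ι} {t N : ℕ}
    (h : ∀ k < N, b i k = b i' k) (hN : Nat.nth (IsBranching b i) t ≤ N) :
    Nat.nth (IsBranching b i') t = Nat.nth (IsBranching b i) t := by
  set j := Nat.nth (IsBranching b i) t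
  have hj : IsBranching b i j := Nat.nth_mem_of_infinite (infinite_branching hb i) t
  have hpre : ∀ k < j, b i k = b i' k := fun k hk => h k (hk.trans_le hN)
  have hc : Nat.count (IsBranching b i') j = t := by
    rw [← count_branching_congr hpre]
    exact Nat.count_nth_of_infinite (infinite_branching hb i) t
  rw [← hc]
  exact Nat.nth_count ((isBranching_congr hpre).1 hj)

/-- Given agreement below `k`, a non-branching `k` forces agreement at `k`. A branching `k` is
recorded by `compress` at an index at most `k`, the number of earlier branching levels. -/
theorem eq_of_compress_eq {i i' : ι} {N : ℕ}
    (h : ∀ t < N, compress b i t = compress b i' t) : ∀ k < N, b i k = b i' k := by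
  classical
  intro k
  induction k using Nat.strong_induction_on with
  | _ k ih =>
    intro hk
    have hpre : ∀ l < k, b i l = b i' l := fun l hl => ih l hl (hl.trans hk)
    by_cases hbr : IsBranching b i k
    · have h1 := h (Nat.count (IsBranching b i) k) ((Nat.count_le (IsBranching b i)).trans_lt hk)
      unfold compress at h1
      rwa [Nat.nth_count hbr, count_branching_congr hpre,
        Nat.nth_count ((isBranching_congr hpre).1 hbr)] at h1
    · by_contra hne
      exact hbr ⟨i', fun l hl => (hpre l hl).symm, Ne.symm hne⟩

/-- There are only finitely many prefixes of length `N`, so it suffices to bound `M` for each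
prefix. -/
theorem exists_bound_branching (hb : NoIsolated b) (N : ℕ) :
    ∃ M, ∀ i, ∃ j, N ≤ j ∧ j < M ∧ IsBranching b i j := by
  have h : ∀ w : Fin N → Bool, ∃ M, ∀ i, (∀ k : Fin N, b i k = w k) →
      ∃ j, N ≤ j ∧ j < M ∧ IsBranching b i j := by
    intro w
    by_cases hw : ∃ i, ∀ k : Fin N, b i k = w k
    · obtain ⟨i₀, h₀⟩ := hw
      obtain ⟨j, hj, hbr⟩ := exists_branching_ge hb i₀ N
      refine ⟨j + 1, fun i hi => ?_⟩
      -- A member with the same prefix as `i₀` either follows it up to `j` and branches there, or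
      -- leaves it earlier, and the point of departure is itself a branching level.
      by_cases hag : ∀ k < j, b i k = b i₀ k
      · exact ⟨j, hj, by omega, (isBranching_congr hag).2 hbr⟩
      · push Not at hag
        obtain ⟨k, hk, hne⟩ := hag
        obtain ⟨l, hl, hl1, hl2⟩ := exists_first_ne hne
        refine ⟨l, not_lt.1 fun hlt => hl2 ?_, by omega, i₀, fun m hm => (hl1 m hm).symm, hl2.symm⟩
        exact (hi ⟨l, hlt⟩).trans (h₀ ⟨l, hlt⟩).symm
    · exact ⟨0, fun i hi => absurd ⟨i, hi⟩ hw⟩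
  choose M hM using h
  refine ⟨Finset.univ.sup M, fun i => ?_⟩
  obtain ⟨j, h1, h2, h3⟩ := hM (fun k => b i k) i fun _ => rfl
  exact ⟨j, h1, h2.trans_le (Finset.le_sup (Finset.mem_univ _)), h3⟩

theorem exists_bound_nth_branching (hb : NoIsolated b) (t : ℕ) :
    ∃ N, ∀ i, Nat.nth (IsBranching b i) t < N := by
  classical
  suffices ∃ N, ∀ i, t < Nat.count (IsBranching b i) N from
    this.imp fun N hN i => (Nat.lt_nth_iff_count_lt (infinite_branching hb i)).1 (hN i)
  induction t with
  | zero =>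
    obtain ⟨M, hM⟩ := exists_bound_branching hb 0
    refine ⟨M, fun i => ?_⟩
    obtain ⟨j, -, hj, hbr⟩ := hM i
    exact (Nat.zero_le _).trans_lt (Nat.count_strict_mono hbr hj)
  | succ t ih =>
    obtain ⟨N, hN⟩ := ih
    obtain ⟨M, hM⟩ := exists_bound_branching hb N
    refine ⟨M, fun i => ?_⟩
    obtain ⟨j, hNj, hj, hbr⟩ := hM i
    have h1 := hN i
    have h2 := Nat.count_monotone (IsBranching b i) hNj
    have h3 := Nat.count_strict_mono hbr hj
    omega

theorem exists_prefix_determines_compress (hb : NoIsolated b) (M : ℕ) :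
    ∃ N, ∀ i i', (∀ k < N, b i k = b i' k) → ∀ t < M, compress b i t = compress b i' t := by
  choose N hN using exists_bound_nth_branching hb
  refine ⟨(Finset.range M).sup N, fun i i' h t ht => ?_⟩
  have hlt : Nat.nth (IsBranching b i) t < (Finset.range M).sup N :=
    (hN t i).trans_le (Finset.le_sup (Finset.mem_range.2 ht))
  unfold compress
  rw [nth_branching_congr hb h hlt.le]
  exact h _ hlt

/-- A wrong bit at index `M` is corrected by passing to a member that splits off exactly at the
`M`-th branching level; the earlier bits are kept. -/
theorem exists_compress_prefix [Nonempty ι] (hb : NoIsolated b) (w : ℕ → Bool) (M : ℕ) :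
    ∃ i, ∀ t < M, compress b i t = w t := by
  induction M with
  | zero => exact ⟨Classical.arbitrary ι, fun t ht => absurd ht (by omega)⟩
  | succ M ih =>
    obtain ⟨i, hi⟩ := ih
    by_cases hM : compress b i M = w M
    · exact ⟨i, fun t ht => (Nat.lt_succ_iff_lt_or_eq.1 ht).elim (hi t) fun h => h ▸ hM⟩
    obtain ⟨i', hpre, hne⟩ := Nat.nth_mem_of_infinite (infinite_branching hb i) M
    have hpre' := fun k hk => (hpre k hk).symm
    refine ⟨i', fun t ht => ?_⟩
    have hle : Nat.nth (IsBranching b i) t ≤ Nat.nth (IsBranching b i) M :=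
      Nat.nth_monotone (infinite_branching hb i) (by omega)
    have heq := nth_branching_congr hb hpre' hle
    unfold compress at hi hM ⊢
    rw [heq]
    rcases Nat.lt_succ_iff_lt_or_eq.1 ht with h | rfl
    · rw [hpre _ ((Nat.nth_lt_nth (infinite_branching hb i)).2 h), hi t h]
    · revert hne hM
      cases b i' _ <;> cases b i _ <;> cases w t <;> simp

theorem denseRange_compress [Nonempty ι] (hb : NoIsolated b) : DenseRange (compress b) := by
  rw [DenseRange, dense_iff_inter_open]
  intro O hO ⟨w, hw⟩
  obtain ⟨s, ⟨x, M, rfl⟩, hws, hs⟩ :=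
    (PiNat.isTopologicalBasis_cylinders fun _ : ℕ => Bool).exists_subset_of_mem_open hw hO
  obtain ⟨i, hi⟩ := exists_compress_prefix hb w M
  exact ⟨_, hs fun t ht => (hi t ht).trans (hws t ht), i, rfl⟩

/-- Each point has a cylinder inside `U` or inside its complement; compactness makes the length
uniform. -/
theorem exists_prefix_determines_mem (U : ClopenAlg) :
    ∃ N, ∀ x y : CantorSpace, (∀ k < N, x k = y k) → (x ∈ U ↔ y ∈ U) := by
  let G : ℕ → Set CantorSpace := fun N =>
    {x | ∀ y ∈ PiNat.cylinder x N, (x ∈ U ↔ y ∈ U)}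
  have hG : ∀ N, ∀ x ∈ G N, PiNat.cylinder x N ⊆ G N := fun N x hx y hy z hz =>
    (hx y hy).symm.trans (hx z fun k hk => (hz k hk).trans (hy k hk))
  have hopen : ∀ N, IsOpen (G N) := fun N => isOpen_iff_mem_nhds.2 fun x hx =>
    Filter.mem_of_superset ((PiNat.isOpen_cylinder _ x N).mem_nhds (PiNat.self_mem_cylinder x N))
      (hG N x hx)
  have hmono : Monotone G := fun M N hMN x hx y hy => hx y (PiNat.cylinder_anti x hMN hy)
  have hcov : univ ⊆ ⋃ N, G N := fun x _ => by
    have key : ∀ O : Set CantorSpace, IsOpen O → x ∈ O → ∃ N, PiNat.cylinder x N ⊆ O := by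
      intro O hO hx
      obtain ⟨s, ⟨z, M, rfl⟩, hxs, hs⟩ :=
        (PiNat.isTopologicalBasis_cylinders fun _ : ℕ => Bool).exists_subset_of_mem_open hx hO
      exact ⟨M, fun y hy => hs fun k hk => (hy k hk).trans (hxs k hk)⟩
    by_cases hx : x ∈ U
    · obtain ⟨N, hN⟩ := key _ U.isOpen hx
      exact mem_iUnion.2 ⟨N, fun y hy => iff_of_true hx (hN hy)⟩
    · obtain ⟨N, hN⟩ := key _ U.isClosed.isOpen_compl hx
      exact mem_iUnion.2 ⟨N, fun y hy => iff_of_false hx (hN hy)⟩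
  obtain ⟨N, hN⟩ := isCompact_univ.elim_directed_cover G hopen hcov
    (directed_of_isDirected_le fun _ _ h => hmono h)
  exact ⟨N, fun x y h => hN (mem_univ x) y fun k hk => (h k hk).symm⟩

/-- `compress` is uniformly continuous in both directions, so finite prefixes before and after carry
the same information. -/
theorem mem_range_visits_compress {b : ℤ → ℕ → Bool} (hb : NoIsolated b) {c : ℤ → Prop} :
    c ∈ range (visits (compress b)) ↔
      ∃ N, ∀ n n', (∀ k < N, b n k = b n' k) → (c n ↔ c n') := by
  constructor
  · rintro ⟨U, rfl⟩
    obtain ⟨M, hM⟩ := exists_prefix_determines_mem U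
    obtain ⟨N, hN⟩ := exists_prefix_determines_compress hb M
    exact ⟨N, fun n n' h => hM _ _ (hN n n' h)⟩
  · rintro ⟨N, hN⟩
    let r : CantorSpace → Fin N → Bool := fun w k => w k
    have hr : Continuous r := continuous_pi fun k => continuous_apply _
    let U : ClopenAlg := ⟨r ⁻¹' {u | ∃ n, c n ∧ r (compress b n) = u},
      (isClopen_discrete _).preimage hr⟩
    refine ⟨U, ?_⟩
    funext n
    refine propext ⟨?_, fun h => ⟨n, h, rfl⟩⟩
    rintro ⟨m, hm, hmn⟩
    exact (hN m n (eq_of_compress_eq fun t ht => congrFun hmn ⟨t, ht⟩)).1 hm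

end Compression

/-! ### Measurability of the compression -/

theorem measurable_nth {Ω : Type*} [MeasurableSpace Ω] {P : Ω → ℕ → Prop}
    (hP : ∀ j, MeasurableSet {ω | P ω j}) (hinf : ∀ ω, (Set.ofPred (P ω)).Infinite) (t : ℕ) :
    Measurable fun ω => Nat.nth (P ω) t := by
  classical
  have hcount : ∀ n, Measurable fun ω => Nat.count (P ω) n := by
    intro n
    induction n with
    | zero => simp
    | succ n ih =>
      simp only [Nat.count_succ]
      exact ih.add (Measurable.ite (hP n) measurable_const measurable_const)
  refine measurable_of_Iio fun m => ?_
  have : (fun ω => Nat.nth (P ω) t) ⁻¹' Iio m = (fun ω => Nat.count (P ω) m) ⁻¹' Ioi t := by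
    ext ω
    exact (Nat.lt_nth_iff_count_lt (hinf ω)).symm
  rw [this]
  exact hcount m measurableSet_Ioi

theorem measurable_compress {Ω ι : Type*} [MeasurableSpace Ω] [Countable ι]
    {b : Ω → ι → ℕ → Bool} (hm : ∀ i k, Measurable fun ω => b ω i k)
    (hb : ∀ ω, NoIsolated (b ω)) (i : ι) : Measurable fun ω => compress (b ω) i := by
  refine measurable_pi_iff.2 fun t => ?_
  have hn : Measurable fun ω => Nat.nth (IsBranching (b ω) i) t := by
    refine measurable_nth (fun j => ?_) (fun ω => infinite_branching (hb ω) i) t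
    simp only [IsBranching, ofPred_exists, ofPred_and, ofPred_forall]
    refine MeasurableSet.iUnion fun i' => MeasurableSet.inter ?_ ?_
    · exact MeasurableSet.iInter fun k => MeasurableSet.iInter fun _ =>
        measurableSet_eq_fun (hm i' k) (hm i k)
    · exact (measurableSet_eq_fun (hm i' j) (hm i j)).compl
  have hu : Measurable fun p : Ω × ℕ => b p.1 i p.2 :=
    measurable_from_prod_countable_left fun k => hm i k
  exact hu.comp (measurable_id.prodMk hn)

/-! ### Toeplitz sequences around the 2-adic point `1/3` -/

/-- The 2-adic proximity of an integer to `1/3`. -/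
def closeness (n : ℤ) : ℕ := padicValInt 2 (3 * n - 1)

theorem closeness_eq_iff {n : ℤ} {v : ℕ} :
    closeness n = v ↔ (2 : ℤ) ^ v ∣ 3 * n - 1 ∧ ¬(2 : ℤ) ^ (v + 1) ∣ 3 * n - 1 := by
  have h0 : 3 * n - 1 ≠ 0 := by omega
  have h : ∀ k : ℕ, (2 : ℤ) ^ k ∣ 3 * n - 1 ↔ k ≤ closeness n := fun k => by
    have := padicValInt_dvd_iff (p := 2) k (3 * n - 1)
    simpa [h0, closeness] using this
  rw [h, h]
  omega

theorem exists_closeness_eq (v : ℕ) : ∃ n, closeness n = v := by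
  -- As `-2 ≡ 1` mod 3, the equation `3m - 1 = -(-2)^v` has an integer solution.
  obtain ⟨m, hm⟩ : (3 : ℤ) ∣ 1 - (-2) ^ v := by
    simpa using sub_dvd_pow_sub_pow (1 : ℤ) (-2) v
  refine ⟨m, closeness_eq_iff.2 ?_⟩
  have h : 3 * m - 1 = -(-2 : ℤ) ^ v := by rw [← hm]; ring
  rw [h, dvd_neg, dvd_neg, neg_pow, pow_succ]
  rcases neg_one_pow_eq_or ℤ v with h1 | h1 <;> rw [h1] <;>
    simp only [one_mul, neg_mul, dvd_neg, dvd_refl, true_and] <;>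
    exact fun h2 => absurd (Int.le_of_dvd (by positivity) h2) (by
      have : (0 : ℤ) < 2 ^ v := by positivity
      omega)

theorem closeness_add {n k : ℤ} {v : ℕ} (hn : closeness n = v) (hk : (2 : ℤ) ^ (v + 1) ∣ k) :
    closeness (n + k) = v := by
  rw [closeness_eq_iff] at hn ⊢
  have h : 3 * (n + k) - 1 = 3 * n - 1 + 3 * k := by ring
  rw [h, dvd_add_left ((pow_dvd_pow 2 v.le_succ).trans (hk.mul_left 3)),
    dvd_add_left (hk.mul_left 3)]
  exact hn

/-- Away from `1/3`, translates of `closeness` do not distinguish integers close to `1/3`. -/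
theorem exists_closeness_add_eq {k : ℤ} (hk : k ≠ 0) :
    ∃ L, ∀ n n', L ≤ closeness n → L ≤ closeness n' → closeness (n + k) = closeness (n' + k) := by
  have h0 : 3 * k ≠ 0 := by omega
  -- In `3(n + k) - 1 = (3n - 1) + 3k` the summand `3k` has the strictly smaller valuation once `n`
  -- is this close to `1/3`.
  refine ⟨padicValInt 2 (3 * k) + 1, ?_⟩
  have key : ∀ n, padicValInt 2 (3 * k) + 1 ≤ closeness n →
      closeness (n + k) = padicValInt 2 (3 * k) := by
    intro n hn
    have hd : ∀ j : ℕ, (2 : ℤ) ^ j ∣ 3 * k ↔ j ≤ padicValInt 2 (3 * k) := fun j => by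
      have := padicValInt_dvd_iff (p := 2) j (3 * k)
      simpa [h0] using this
    have hn' : (2 : ℤ) ^ (padicValInt 2 (3 * k) + 1) ∣ 3 * n - 1 :=
      (pow_dvd_pow 2 hn).trans (closeness_eq_iff.1 rfl).1
    have h : 3 * (n + k) - 1 = 3 * n - 1 + 3 * k := by ring
    rw [closeness_eq_iff, h, dvd_add_right ((pow_dvd_pow 2 (Nat.le_succ _)).trans hn'),
      dvd_add_right hn', hd, hd]
    omega
  exact fun n n' hn hn' => (key n hn).trans (key n' hn').symm

/-- An enumeration of the clopen sets in which each of them occurs infinitely often. -/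
noncomputable def clopenSeq (m : ℕ) : ClopenAlg :=
  (exists_surjective_nat ClopenAlg).choose m.unpair.1

theorem exists_clopenSeq_eq (U : ClopenAlg) (L : ℕ) : ∃ m ≥ L, clopenSeq m = U := by
  obtain ⟨i, hi⟩ := (exists_surjective_nat ClopenAlg).choose_spec U
  exact ⟨Nat.pair i L, Nat.right_le_pair i L, by simp only [clopenSeq, Nat.unpair_pair, hi]⟩

open Classical in
/-- A Toeplitz sequence attached to a point of the Cantor space. -/
noncomputable def toeplitz (c : CantorSpace) (n : ℤ) : Bool :=
  decide (c ∈ clopenSeq (closeness n))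

theorem toeplitz_eq_toeplitz {c d : CantorSpace} {n m : ℤ} : toeplitz c n = toeplitz d m ↔
    (c ∈ clopenSeq (closeness n) ↔ d ∈ clopenSeq (closeness m)) := by
  simp [toeplitz]

theorem exists_toeplitz_period (c : CantorSpace) (n : ℤ) :
    ∃ l : ℕ, ∀ k, (2 : ℤ) ^ l ∣ k → toeplitz c (n + k) = toeplitz c n :=
  ⟨closeness n + 1, fun k hk => by rw [toeplitz_eq_toeplitz, closeness_add rfl hk]⟩

/-- None of these Toeplitz sequences has a power of two as a period. -/
theorem exists_toeplitz_ne (c : CantorSpace) (l : ℕ) :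
    ∃ n k, (2 : ℤ) ^ l ∣ k ∧ toeplitz c (n + k) ≠ toeplitz c n := by
  -- Two integers within `2^l` of `1/3` differ by a multiple of `2^l`, yet the sequence reads `⊥` at
  -- one and `⊤` at the other.
  obtain ⟨v, hv, hvU⟩ := exists_clopenSeq_eq ⊥ l
  obtain ⟨w, hw, hwU⟩ := exists_clopenSeq_eq ⊤ l
  obtain ⟨n, hn⟩ := exists_closeness_eq v
  obtain ⟨m, hm⟩ := exists_closeness_eq w
  refine ⟨n, m - n, ?_, fun h => ?_⟩
  · have h1 := (pow_dvd_pow 2 hv).trans (closeness_eq_iff.1 hn).1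
    have h2 := (pow_dvd_pow 2 hw).trans (closeness_eq_iff.1 hm).1
    have h3 := dvd_sub h2 h1
    rw [show 3 * m - 1 - (3 * n - 1) = 3 * (m - n) by ring] at h3
    exact (IsCoprime.pow_left (by norm_num)).dvd_of_dvd_mul_left h3
  · rw [add_sub_cancel, toeplitz_eq_toeplitz, hn, hm, hvU, hwU] at h
    exact h.1 trivial

/-! ### The algebra of a set of points, and recovery of the set -/

/-- The shift-invariant Boolean algebra generated by the Toeplitz sequences attached to the points
of `S`: its elements depend on finitely many terms of them. -/
def toeplitzAlgebra (S : Set CantorSpace) : Set (ℤ → Prop) :=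
  {c | ∃ D : Finset (CantorSpace × ℤ), (∀ p ∈ D, p.1 ∈ S) ∧
    ∀ n n', (∀ p ∈ D, toeplitz p.1 (n + p.2) = toeplitz p.1 (n' + p.2)) → (c n ↔ c n')}

theorem toeplitz_mem_toeplitzAlgebra {S : Set CantorSpace} {r : CantorSpace} :
    (fun n => toeplitz r n = true) ∈ toeplitzAlgebra S ↔ r ∈ S := by
  constructor
  · rintro ⟨D, hDS, hD⟩
    by_contra hr
    have hne : r ∈ {w | ∃ p ∈ D, p.1 = w}ᶜ := by
      rintro ⟨p, hp, rfl⟩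
      exact hr (hDS p hp)
    have hfin : {w | ∃ p ∈ D, p.1 = w}.Finite := D.finite_toSet.image Prod.fst
    -- `V` separates `r` from the finitely many points used by `D`. Near `1/3`, times indexing `V`
    -- and `⊥` look alike to all of `D`: nonzero translates are constant there, and untranslated
    -- sequences read false at both. The sequence of `r` tells them apart.
    obtain ⟨V, hrV, hV⟩ := exists_clopen_sub hfin.isClosed.isOpen_compl hne
    have hL : ∀ p : CantorSpace × ℤ, ∃ L, p.2 ≠ 0 → ∀ n n', L ≤ closeness n →
        L ≤ closeness n' → closeness (n + p.2) = closeness (n' + p.2) := fun p => by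
      by_cases h : p.2 = 0
      · exact ⟨0, fun h' => absurd h h'⟩
      · exact (exists_closeness_add_eq h).imp fun L hL _ => hL
    choose L hL using hL
    obtain ⟨v, hv, hvV⟩ := exists_clopenSeq_eq V (D.sup L)
    obtain ⟨w, hw, hwV⟩ := exists_clopenSeq_eq ⊥ (D.sup L)
    obtain ⟨n, rfl⟩ := exists_closeness_eq v
    obtain ⟨m, rfl⟩ := exists_closeness_eq w
    have h := hD n m fun p hp => by
      rw [toeplitz_eq_toeplitz]
      by_cases h0 : p.2 = 0
      · rw [h0, add_zero, add_zero, hvV, hwV]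
        exact iff_of_false (fun h => hV h ⟨p, hp, rfl⟩) fun h => h
      · have hle : L p ≤ D.sup L := Finset.le_sup hp
        rw [hL p h0 n m (hle.trans hv) (hle.trans hw)]
    have h' := toeplitz_eq_toeplitz.1 (Bool.eq_iff_iff.2 h)
    rw [hvV, hwV] at h'
    exact h'.1 hrV
  · intro hr
    refine ⟨{(r, 0)}, by simpa using hr, fun n n' h => ?_⟩
    have := h (r, 0) (by simp)
    simp only [add_zero] at this
    simp only [this]

theorem toeplitzAlgebra_injective : Function.Injective toeplitzAlgebra := by
  intro S T h
  ext r
  rw [← toeplitz_mem_toeplitzAlgebra (S := S), h, toeplitz_mem_toeplitzAlgebra]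

theorem shift_mem_toeplitzAlgebra {S : Set CantorSpace} {c : ℤ → Prop}
    (hc : c ∈ toeplitzAlgebra S) (k : ℤ) : (fun n => c (n + k)) ∈ toeplitzAlgebra S := by
  classical
  obtain ⟨D, hDS, hD⟩ := hc
  refine ⟨D.image fun p => (p.1, k + p.2), ?_, fun n n' h => hD _ _ fun p hp => ?_⟩
  · simp only [Finset.mem_image]
    rintro _ ⟨p, hp, rfl⟩
    exact hDS p hp
  · simpa only [add_assoc] using h _ (Finset.mem_image_of_mem _ hp)

theorem exists_period_of_mem_toeplitzAlgebra {S : Set CantorSpace} {c : ℤ → Prop}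
    (hc : c ∈ toeplitzAlgebra S) (n : ℤ) :
    ∃ l : ℕ, ∀ k, (2 : ℤ) ^ l ∣ k → (c (n + k) ↔ c n) := by
  obtain ⟨D, -, hD⟩ := hc
  choose l hl using fun p : CantorSpace × ℤ => exists_toeplitz_period p.1 (n + p.2)
  refine ⟨D.sup l, fun k hk => hD _ _ fun p hp => ?_⟩
  rw [add_right_comm]
  exact hl p k ((pow_dvd_pow 2 (Finset.le_sup hp)).trans hk)

/-! ### The dense orbit realising the algebra -/

/-- All translates of the Toeplitz sequences attached to the terms of `x`, read at `n`. -/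
noncomputable def toeplitzCode (x : ℕ → CantorSpace) (n : ℤ) (j : ℕ) : Bool :=
  toeplitz (x (Denumerable.ofNat (ℕ × ℤ) j).1) (n + (Denumerable.ofNat (ℕ × ℤ) j).2)

theorem toeplitzCode_encode (x : ℕ → CantorSpace) (n : ℤ) (p : ℕ × ℤ) :
    toeplitzCode x n (Encodable.encode p) = toeplitz (x p.1) (n + p.2) := by
  rw [toeplitzCode, Denumerable.ofNat_encode]

theorem mem_toeplitzAlgebra_range {x : ℕ → CantorSpace} {c : ℤ → Prop} :
    c ∈ toeplitzAlgebra (range x) ↔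
      ∃ N, ∀ n n', (∀ k < N, toeplitzCode x n k = toeplitzCode x n' k) → (c n ↔ c n') := by
  classical
  constructor
  · rintro ⟨D, hDS, hD⟩
    have : ∀ p : D, ∃ i, x i = p.1.1 := fun p => hDS p.1 p.2
    choose i hi using this
    let M : D → ℕ := fun p => Encodable.encode (i p, p.1.2) + 1
    refine ⟨Finset.univ.sup M, fun n n' h => hD n n' fun p hp => ?_⟩
    have hM : M ⟨p, hp⟩ ≤ Finset.univ.sup M := Finset.le_sup (Finset.mem_univ _)
    have h1 := h (Encodable.encode (i ⟨p, hp⟩, p.2)) hM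
    simpa only [toeplitzCode_encode, hi] using h1
  · rintro ⟨N, hN⟩
    unfold toeplitzCode at hN
    generalize Denumerable.ofNat (ℕ × ℤ) = e at hN
    refine ⟨(Finset.range N).image fun j => (x (e j).1, (e j).2), fun p hp => ?_,
      fun n n' h => hN n n' fun j hj => ?_⟩
    · obtain ⟨j, -, rfl⟩ := Finset.mem_image.1 hp
      exact mem_range_self _
    · exact h (x (e j).1, (e j).2)
        (Finset.mem_image.2 ⟨j, Finset.mem_range.2 hj, rfl⟩)

/-- The times sharing a prefix with `n` include a progression `n + 2^l ℤ`. If all had the same code,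
then, as the code records every translate, `2^l` would be a period of the sequence of `x 0`. -/
theorem noIsolated_toeplitzCode (x : ℕ → CantorSpace) : NoIsolated (toeplitzCode x) := by
  intro n N
  have hc : (fun m => ∀ k < N, toeplitzCode x m k = toeplitzCode x n k) ∈
      toeplitzAlgebra (range x) :=
    mem_toeplitzAlgebra_range.2 ⟨N, fun m m' h =>
      forall₂_congr fun k hk => by rw [h k hk]⟩
  obtain ⟨l, hl⟩ := exists_period_of_mem_toeplitzAlgebra hc n
  obtain ⟨m, k, hk, hne⟩ := exists_toeplitz_ne (x 0) l
  by_contra! h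
  refine hne ?_
  have h1 := congrFun (h (n + k) ((hl k hk).2 fun _ _ => rfl)) (Encodable.encode ((0 : ℕ), m - n))
  rw [toeplitzCode_encode, toeplitzCode_encode] at h1
  convert h1 using 2 <;> ring

/-- The orbit of the base point of the system attached to `x`. -/
noncomputable def toeplitzOrbit (x : ℕ → CantorSpace) : ℤ → CantorSpace := compress (toeplitzCode x)

theorem denseRange_toeplitzOrbit (x : ℕ → CantorSpace) : DenseRange (toeplitzOrbit x) :=
  denseRange_compress (noIsolated_toeplitzCode x)

theorem range_visits_toeplitzOrbit (x : ℕ → CantorSpace) :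
    range (visits (toeplitzOrbit x)) = toeplitzAlgebra (range x) :=
  Set.ext fun _ => (mem_range_visits_compress (noIsolated_toeplitzCode x)).trans
    mem_toeplitzAlgebra_range.symm

theorem exists_homeo_shift_toeplitzOrbit (x : ℕ → CantorSpace) :
    ∃ φ : CantorHomeo, ∀ n, φ (toeplitzOrbit x n) = toeplitzOrbit x (n + 1) := by
  have hd := denseRange_toeplitzOrbit x
  have hd' : DenseRange fun n => toeplitzOrbit x (n + 1) := by
    have h := (add_right_surjective (1 : ℤ)).range_comp (toeplitzOrbit x)
    change Dense (range (toeplitzOrbit x ∘ fun n => n + 1))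
    rwa [h]
  refine exists_homeo_of_range_visits_eq hd hd' ?_
  have hv : ∀ U n, visits (fun n => toeplitzOrbit x (n + 1)) U n =
    visits (toeplitzOrbit x) U (n + 1) := fun _ _ => rfl
  have hr := range_visits_toeplitzOrbit x
  ext c
  constructor
  · intro hc
    rw [hr] at hc
    have := shift_mem_toeplitzAlgebra hc (-1)
    rw [← hr] at this
    obtain ⟨U, hU⟩ := this
    refine ⟨U, funext fun n => ?_⟩
    simp only [hv, hU, add_neg_cancel_right]
  · rintro ⟨U, rfl⟩
    rw [hr]
    exact shift_mem_toeplitzAlgebra (hr ▸ mem_range_self U) 1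

/-! ### Minimality and the attached pointed system -/

theorem isMinimalHomeo_of_visits_periodic {φ : CantorHomeo} {q : ℤ → CantorSpace}
    (hq : DenseRange q) (hφ : ∀ n, φ (q n) = q (n + 1))
    (hper : ∀ U n, visits q U n → ∃ p : ℕ, 0 < p ∧ ∀ k, (p : ℤ) ∣ k → visits q U (n + k)) :
    IsMinimalHomeo φ := by
  intro Y hY hinv
  by_contra! hne
  obtain ⟨⟨y, hy⟩, hY1⟩ := hne
  obtain ⟨x, hx⟩ := (ne_univ_iff_exists_notMem Y).1 hY1
  obtain ⟨V, hxV, hVY⟩ := exists_clopen_sub hY.isOpen_compl hx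
  obtain ⟨n, hn⟩ := hq.exists_mem_open V.isOpen ⟨x, hxV⟩
  obtain ⟨p, hp, hper⟩ := hper V n hn
  have hiter : ∀ k m, φ^[k] (q m) = q (m + k) := by
    intro k
    induction k with
    | zero => simp
    | succ k ih =>
      intro m
      rw [Function.iterate_succ_apply, hφ, ih]
      congr 1
      push_cast
      ring
  have hstay : ∀ k, φ^[k] y ∈ Y := by
    intro k
    induction k with
    | zero => exact hy
    | succ k ih =>
      rw [Function.iterate_succ_apply', ← hinv]
      exact mem_image_of_mem _ ih
  have hclosed : IsClosed (⋃ k ∈ Finset.range p, φ^[k] ⁻¹' (V : Set CantorSpace)) :=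
    isClosed_biUnion_finset fun k _ => V.isClosed.preimage (φ.continuous.iterate k)
  -- Any `p` consecutive times include one congruent to `n` mod `p`, so every orbit point enters `V`
  -- in fewer than `p` steps. This is a closed condition, so it passes to `y`, whose iterates stay
  -- in `Y`.
  have hcov : range q ⊆ ⋃ k ∈ Finset.range p, φ^[k] ⁻¹' (V : Set CantorSpace) := by
    rintro _ ⟨m, rfl⟩
    have hp' : (0 : ℤ) < p := by exact_mod_cast hp
    obtain ⟨k, hk⟩ := Int.eq_ofNat_of_zero_le (Int.emod_nonneg (n - m) hp'.ne')
    have hlt := Int.emod_lt_of_pos (n - m) hp'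
    refine mem_biUnion (x := k) (by simpa using (by omega : k < p)) ?_
    rw [mem_preimage, hiter]
    have hdvd : (p : ℤ) ∣ m + k - n := by
      rw [← hk, ← dvd_neg]
      have := Int.dvd_sub_self_of_emod_eq (a := n - m) (b := p) rfl
      rwa [show -(m + (n - m) % p - n) = n - m - (n - m) % (p : ℤ) by ring, ← dvd_neg, neg_sub]
    have := hper _ hdvd
    rwa [add_sub_cancel] at this
  obtain ⟨k, -, hk⟩ := mem_iUnion₂.1
    (closure_minimal hcov hclosed (hq y))
  exact hVY hk (hstay k)

/-- The pointed minimal system attached to a sequence of points of the Cantor space. -/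
noncomputable def toeplitzSystem (x : ℕ → CantorSpace) : PointedCantorMinimalSystem :=
  (⟨(exists_homeo_shift_toeplitzOrbit x).choose,
    isMinimalHomeo_of_visits_periodic (denseRange_toeplitzOrbit x)
      (exists_homeo_shift_toeplitzOrbit x).choose_spec fun U n hn => by
        have hU : visits (toeplitzOrbit x) U ∈ toeplitzAlgebra (range x) :=
          range_visits_toeplitzOrbit x ▸ mem_range_self U
        obtain ⟨l, hl⟩ := exists_period_of_mem_toeplitzAlgebra hU n
        exact ⟨2 ^ l, by positivity, fun k hk => (hl k (by exact_mod_cast hk)).2 hn⟩⟩,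
    toeplitzOrbit x 0)

theorem orbit_toeplitzSystem (x : ℕ → CantorSpace) : orbit (toeplitzSystem x) = toeplitzOrbit x :=
  (eq_orbit rfl (exists_homeo_shift_toeplitzOrbit x).choose_spec).symm

theorem pointedConjugacy_toeplitzSystem (x y : ℕ → CantorSpace) :
    pointedConjugacy (toeplitzSystem x) (toeplitzSystem y) ↔ range x = range y := by
  rw [pointedConjugacy_iff, orbit_toeplitzSystem, orbit_toeplitzSystem,
    range_visits_toeplitzOrbit, range_visits_toeplitzOrbit, toeplitzAlgebra_injective.eq_iff]

/-! ### Borel measurability of the construction -/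

theorem imageClopen_eq_iff_orbit (a : PointedCantorMinimalSystem) (U V : ClopenAlg) :
    imageClopen a.1.1 U = V ↔ ∀ n, orbit a n ∈ U ↔ orbit a (n + 1) ∈ V := by
  constructor
  · rintro rfl n
    rw [orbit_add_one, mem_imageClopen]
  · intro h
    have hv : visits (orbit a) (imageClopen a.1.1 U) = visits (orbit a) V := by
      funext n
      have h1 := h (n - 1)
      rw [sub_add_cancel, ← mem_imageClopen (φ := a.1.1), ← orbit_add_one, sub_add_cancel] at h1
      exact propext h1
    exact le_antisymm ((visits_le_visits (denseRange_orbit a)).1 hv.le)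
      ((visits_le_visits (denseRange_orbit a)).1 hv.ge)

/-- The dense orbit determines the homeomorphism through countably many conditions, so a
homeomorphism obtained by choice still depends measurably on the parameter. -/
theorem measurable_of_measurable_orbit {Ω : Type*} [MeasurableSpace Ω]
    {F : Ω → PointedCantorMinimalSystem} (hF : ∀ n, Measurable fun ω => orbit (F ω) n) :
    Measurable F := by
  refine Measurable.prodMk (Measurable.subtype_mk ?_) (by simpa only [orbit_zero] using hF 0)
  rw [← measurableEmbedding_imageClopen.measurable_comp_iff]
  refine measurable_pi_iff.2 fun U => measurable_to_countable' fun V => ?_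
  have : (fun ω => imageClopen (F ω).1.1 U) ⁻¹' {V} =
      {ω | ∀ n, orbit (F ω) n ∈ U ↔ orbit (F ω) (n + 1) ∈ V} := by
    ext ω
    exact imageClopen_eq_iff_orbit (F ω) U V
  change MeasurableSet ((fun ω => imageClopen (F ω).1.1 U) ⁻¹' {V})
  rw [this, ofPred_forall]
  refine MeasurableSet.iInter fun n => ?_
  exact MeasurableSet.iff (hF n (measurableSet_clopenAlg U))
    (hF (n + 1) (measurableSet_clopenAlg V))

theorem measurable_toeplitz (n : ℤ) : Measurable fun c => toeplitz c n := by
  refine measurable_to_bool ?_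
  have : (fun c => toeplitz c n) ⁻¹' {true} = clopenSeq (closeness n) := by
    ext c
    simp [toeplitz]
  rw [this]
  exact measurableSet_clopenAlg _

theorem measurable_toeplitzSystem : Measurable toeplitzSystem := by
  refine measurable_of_measurable_orbit fun n => ?_
  simp only [orbit_toeplitzSystem]
  exact measurable_compress (fun n k => (measurable_toeplitz _).comp (measurable_pi_apply _))
    noIsolated_toeplitzCode n

theorem deltaPlus_le_pointedConjugacy : BorelReducible deltaPlus pointedConjugacy := by
  let e : ℝ ≃ᵐ CantorSpace :=
    PolishSpace.measurableEquivNatBoolOfNotCountable not_countable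
  refine ⟨fun x => toeplitzSystem fun i => e (x i), measurable_toeplitzSystem.comp
    (measurable_pi_iff.2 fun i => e.measurable.comp (measurable_pi_apply i)), fun x y => ?_⟩
  have hr : ∀ x : ℕ → ℝ, range (fun i => e (x i)) = e '' range x := fun x => range_comp e x
  rw [pointedConjugacy_toeplitzSystem, hr, hr, e.injective.image_injective.eq_iff]
  rfl

end CantorMinimal

theorem theorem1p2 :
    CantorMinimal.BorelBireducible CantorMinimal.deltaPlus CantorMinimal.pointedConjugacy :=
  ⟨CantorMinimal.deltaPlus_le_pointedConjugacy, CantorMinimal.pointedConjugacy_le_deltaPlus⟩
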